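/- Let $\mathbf D=(D;\sqcap,\sqcup,\neg,\lrcorner,\top,\bot)$ be a double Boolean algebra (dBa), i.e. an algebra of type $(2,2,1,1,0,0)$ satisfying, with $x\vee y:=\neg(\neg x\sqcap\neg y)$ and $x\wedge y:=\lrcorner(\lrcorner x\sqcup\lrcorner y)$, the identities $(x\sqcap x)\sqcap y=x\sqcap y$; $x\sqcap y=y\sqcap x$; $\neg(x\sqcap x)=\neg x$; $x\sqcap(x\sqcup y)=x\sqcap x$; $x\sqcap(y\vee z)=(x\sqcap y)\vee(x\sqcap z)$; $x\sqcap(x\vee y)=x\sqcap x$; $\neg\neg(x\sqcap y)=x\sqcap y$; $x\sqcap\neg x=\bot$; $\neg\top=\bot$; $x\sqcap(y\sqcap z)=(x\sqcap y)\sqcap z$; $\neg\bot=\top\sqcap\top$; the duals of all these (exchanging $\sqcap,\neg,\top,\vee$ with $\sqcup,\lrcorner,\bot,\wedge$); and $(x\sqcap x)\sqcup(x\sqcap x)=(x\sqcup x)\sqcap(x\sqcup x)$. On any dBa put $x\sqsubseteq y$ iff $x\sqcap y=x\sqcap x$ and $x\sqcup y=y\sqcup y$; the dBa is contextual if $\sqsubseteq$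 is an order relation. A filter is a subset closed under $\sqcap$ and upward closed for $\sqsubseteq$; it is primary if it is non-empty, different from $D$, and contains $x$ or $\neg x$ for every $x\in D$. (Primary) ideals are defined dually, with $\sqcup$, $\lrcorner$ and downward closure. Let $\mathcal F_{pr}(\mathbf D)$ and $\mathcal I_{pr}(\mathbf D)$ be the sets of primary filters and of primary ideals, let $F_x$ and $I_x$ be the sets of primary filters, resp. primary ideals, that contain $x$, and take $\{F_x: x\in D\}$, resp. $\{I_x: x\in D\}$, as a subbase for the closed sets of a topology on $\mathcal F_{pr}(\mathbf D)$, resp. $\mathcal I_{pr}(\mathbf D)$. For $A\subseteq\mathcal F_{pr}(\mathbf D)$ and $B\subseteq\mathcal I_{pr}(\mathbf D)$ let $A'=\{I: F\cap I\ne\emptyset\ \text{for all } F\in A\}$ and $B'=\{F: F\cap I\neq\emptyset\ \text{for all } I\in B\}$, and define on pairs of such sets $$(A,B)\sqcap(C,E)=(A\cap C,(A\cap C)'),\quad (A,B)\sqcup(C,E)=((B\cap E)',B\cap E),$$ $$\neg(A,B)=(A^c,(A^c)'),\quad \lrcorner(A,B)=((B^c)',B^c),\quad \top=(\mathcal F_{pr}(\mathbf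 D),\emptyset),\quad \bot=(\emptyset,\mathcal I_{pr}(\mathbf D)).$$ Theorem. The spaces $\mathcal F_{pr}(\mathbf D)$, $\mathcal I_{pr}(\mathbf D)$ and their product are Stone spaces (compact, Hausdorff, totally disconnected), and for every $x\in D$ the sets $F_x$, $I_x$ and $F_x\times I_x$ are clopen. The set $\mathcal D:=\{(F_x,I_x): x\in D\}$ of pairs of clopen sets is closed under the above operations and is a dBa under them, in which $(A,B)\sqsubseteq(C,E)$ iff $A\subseteq C$ and $E\subseteq B$. The map $h:\mathbf D\to\mathcal D$, $h(x)=(F_x,I_x)$, is a quasi-isomorphism, i.e. a surjective homomorphism (for all six operations) with $x\sqsubseteq y\iff h(x)\sqsubseteq h(y)$ for all $x,y\in D$. If $\mathbf D$ is contextual, then $h$ is an isomorphism. -/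

import Mathlib

/-- Algebras of type `(2,2,1,1,0,0)`: meet, join, negation, opposition, top, bottom. -/
class DBAOps (D : Type*) where
  meet : D → D → D
  join : D → D → D
  neg : D → D
  opp : D → D
  top : D
  bot : D

namespace DBAOps

infixl:70 " ⊓ₐ " => DBAOps.meet
infixl:65 " ⊔ₐ " => DBAOps.join
prefix:max "¬ₐ" => DBAOps.neg
prefix:max "⌟ₐ" => DBAOps.opp
notation "⊤ₐ" => DBAOps.top
notation "⊥ₐ" => DBAOps.bot

variable {D : Type*} [DBAOps D]

/-- The derived operation `x ∨ y := ¬(¬x ⊓ ¬y)`. -/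
def vee (x y : D) : D := ¬ₐ(¬ₐx ⊓ₐ ¬ₐy)

/-- The derived operation `x ∧ y := ⌟(⌟x ⊔ ⌟y)`. -/
def wedge (x y : D) : D := ⌟ₐ(⌟ₐx ⊔ₐ ⌟ₐy)

/-- The relation `x ⊑ y` iff `x ⊓ y = x ⊓ x` and `x ⊔ y = y ⊔ y`. -/
def QLE (x y : D) : Prop := x ⊓ₐ y = x ⊓ₐ x ∧ x ⊔ₐ y = y ⊔ₐ y

infix:50 " ⊑ₐ " => DBAOps.QLE

end DBAOps

open DBAOps

/-- Double Boolean algebras (Wille's twenty-three identities). -/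
class IsDBA (D : Type*) [DBAOps D] : Prop where
  ax1a : ∀ x y : D, (x ⊓ₐ x) ⊓ₐ y = x ⊓ₐ y
  ax1b : ∀ x y : D, (x ⊔ₐ x) ⊔ₐ y = x ⊔ₐ y
  ax2a : ∀ x y : D, x ⊓ₐ y = y ⊓ₐ x
  ax2b : ∀ x y : D, x ⊔ₐ y = y ⊔ₐ x
  ax3a : ∀ x : D, ¬ₐ(x ⊓ₐ x) = ¬ₐx
  ax3b : ∀ x : D, ⌟ₐ(x ⊔ₐ x) = ⌟ₐx
  ax4a : ∀ x y : D, x ⊓ₐ (x ⊔ₐ y) = x ⊓ₐ x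
  ax4b : ∀ x y : D, x ⊔ₐ (x ⊓ₐ y) = x ⊔ₐ x
  ax5a : ∀ x y z : D, x ⊓ₐ vee y z = vee (x ⊓ₐ y) (x ⊓ₐ z)
  ax5b : ∀ x y z : D, x ⊔ₐ wedge y z = wedge (x ⊔ₐ y) (x ⊔ₐ z)
  ax6a : ∀ x y : D, x ⊓ₐ vee x y = x ⊓ₐ x
  ax6b : ∀ x y : D, x ⊔ₐ wedge x y = x ⊔ₐ x
  ax7a : ∀ x y : D, ¬ₐ(¬ₐ(x ⊓ₐ y)) = x ⊓ₐ y
  ax7b : ∀ x y : D, ⌟ₐ(⌟ₐ(x ⊔ₐ y)) = x ⊔ₐ y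
  ax8a : ∀ x : D, x ⊓ₐ ¬ₐx = ⊥ₐ
  ax8b : ∀ x : D, x ⊔ₐ ⌟ₐx = ⊤ₐ
  ax9a : ¬ₐ(⊤ₐ : D) = ⊥ₐ
  ax9b : ⌟ₐ(⊥ₐ : D) = ⊤ₐ
  ax10a : ∀ x y z : D, x ⊓ₐ (y ⊓ₐ z) = (x ⊓ₐ y) ⊓ₐ z
  ax10b : ∀ x y z : D, x ⊔ₐ (y ⊔ₐ z) = (x ⊔ₐ y) ⊔ₐ z
  ax11a : ¬ₐ(⊥ₐ : D) = ⊤ₐ ⊓ₐ ⊤ₐ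
  ax11b : ⌟ₐ(⊤ₐ : D) = ⊥ₐ ⊔ₐ ⊥ₐ
  ax12 : ∀ x : D, (x ⊓ₐ x) ⊔ₐ (x ⊓ₐ x) = (x ⊔ₐ x) ⊓ₐ (x ⊔ₐ x)

namespace DBA

/-- A dBa is contextual if `⊑` is an order relation. -/
def IsContextual (D : Type*) [DBAOps D] : Prop :=
  (∀ x : D, x ⊑ₐ x) ∧ (∀ x y z : D, x ⊑ₐ y → y ⊑ₐ z → x ⊑ₐ z) ∧
    (∀ x y : D, x ⊑ₐ y → y ⊑ₐ x → x = y)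

/-! ### Homomorphisms and subuniverses -/

structure IsHom {A B : Type*} [DBAOps A] [DBAOps B] (f : A → B) : Prop where
  map_meet : ∀ x y, f (x ⊓ₐ y) = f x ⊓ₐ f y
  map_join : ∀ x y, f (x ⊔ₐ y) = f x ⊔ₐ f y
  map_neg : ∀ x, f (¬ₐx) = ¬ₐ(f x)
  map_opp : ∀ x, f (⌟ₐx) = ⌟ₐ(f x)
  map_top : f ⊤ₐ = ⊤ₐ
  map_bot : f ⊥ₐ = ⊥ₐ

/-- A quasi-isomorphism: a surjective homomorphism that preserves and reflects `⊑`. -/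
structure IsQuasiIso {A B : Type*} [DBAOps A] [DBAOps B] (f : A → B) : Prop where
  hom : IsHom f
  surjective : Function.Surjective f
  qle_iff : ∀ x y, x ⊑ₐ y ↔ f x ⊑ₐ f y

/-- An isomorphism: a bijective homomorphism. -/
structure IsIso {A B : Type*} [DBAOps A] [DBAOps B] (f : A → B) : Prop where
  hom : IsHom f
  bijective : Function.Bijective f

/-- A subset closed under the six operations. -/
structure IsSubuniverse {A : Type*} [DBAOps A] (S : Set A) : Prop where
  meet_mem : ∀ x ∈ S, ∀ y ∈ S, x ⊓ₐ y ∈ S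
  join_mem : ∀ x ∈ S, ∀ y ∈ S, x ⊔ₐ y ∈ S
  neg_mem : ∀ x ∈ S, ¬ₐx ∈ S
  opp_mem : ∀ x ∈ S, ⌟ₐx ∈ S
  top_mem : ⊤ₐ ∈ S
  bot_mem : ⊥ₐ ∈ S

/-- The restriction of the operations to a subuniverse. -/
abbrev IsSubuniverse.ops {A : Type*} [DBAOps A] {S : Set A} (hS : IsSubuniverse S) :
    DBAOps S where
  meet x y := ⟨x.1 ⊓ₐ y.1, hS.meet_mem x.1 x.2 y.1 y.2⟩
  join x y := ⟨x.1 ⊔ₐ y.1, hS.join_mem x.1 x.2 y.1 y.2⟩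
  neg x := ⟨¬ₐ(x.1), hS.neg_mem x.1 x.2⟩
  opp x := ⟨⌟ₐ(x.1), hS.opp_mem x.1 x.2⟩
  top := ⟨⊤ₐ, hS.top_mem⟩
  bot := ⟨⊥ₐ, hS.bot_mem⟩

/-! ### Pairs of sets over a formal context -/

/-- A pair `(A, B)` with `A` a set of objects and `B` a set of attributes of the formal context
`(G, M, R)`. -/
@[ext] structure ContextPair {G M : Type*} (R : G → M → Prop) where
  extent : Set G
  intent : Set M

/-- The protoconcept operations. Here `upperPolar R A` is the derivation `A'` of a set of objects
and `lowerPolar R B` is the derivation `B'` of a set of attributes. -/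
instance {G M : Type*} (R : G → M → Prop) : DBAOps (ContextPair R) where
  meet p q := ⟨p.extent ∩ q.extent, upperPolar R (p.extent ∩ q.extent)⟩
  join p q := ⟨lowerPolar R (p.intent ∩ q.intent), p.intent ∩ q.intent⟩
  neg p := ⟨p.extentᶜ, upperPolar R p.extentᶜ⟩
  opp p := ⟨lowerPolar R p.intentᶜ, p.intentᶜ⟩
  top := ⟨Set.univ, ∅⟩
  bot := ⟨∅, Set.univ⟩

/-! ### Primary filters and ideals -/

structure IsFilter {D : Type*} [DBAOps D] (F : Set D) : Prop where
  meet_mem : ∀ x ∈ F, ∀ y ∈ F, x ⊓ₐ y ∈ F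
  mem_of_qle : ∀ x ∈ F, ∀ z, x ⊑ₐ z → z ∈ F

structure IsIdeal {D : Type*} [DBAOps D] (I : Set D) : Prop where
  join_mem : ∀ x ∈ I, ∀ y ∈ I, x ⊔ₐ y ∈ I
  mem_of_qle : ∀ x ∈ I, ∀ z, z ⊑ₐ x → z ∈ I

@[ext] structure PrimaryFilter (D : Type*) [DBAOps D] where
  carrier : Set D
  isFilter : IsFilter carrier
  nonempty : carrier.Nonempty
  proper : carrier ≠ Set.univ
  primary : ∀ x, x ∈ carrier ∨ ¬ₐx ∈ carrier

@[ext] structure PrimaryIdeal (D : Type*) [DBAOps D] where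
  carrier : Set D
  isIdeal : IsIdeal carrier
  nonempty : carrier.Nonempty
  proper : carrier ≠ Set.univ
  primary : ∀ x, x ∈ carrier ∨ ⌟ₐx ∈ carrier

section Representation

variable {D : Type*} [DBAOps D]

/-- `F_x`, the set of primary filters containing `x`. -/
def Fset (x : D) : Set (PrimaryFilter D) := {F | x ∈ F.carrier}

/-- `I_x`, the set of primary ideals containing `x`. -/
def Iset (x : D) : Set (PrimaryIdeal D) := {I | x ∈ I.carrier}

/-- The topology in which the sets `F_x` form a subbase for the closed sets. -/
instance : TopologicalSpace (PrimaryFilter D) :=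
  TopologicalSpace.generateFrom (Set.range fun x : D => (Fset x)ᶜ)

/-- The topology in which the sets `I_x` form a subbase for the closed sets. -/
instance : TopologicalSpace (PrimaryIdeal D) :=
  TopologicalSpace.generateFrom (Set.range fun x : D => (Iset x)ᶜ)

/-- The incidence relation of the standard context: `F Δ I` iff `F ∩ I ≠ ∅`. -/
def StdRel (D : Type*) [DBAOps D] (F : PrimaryFilter D) (I : PrimaryIdeal D) : Prop :=
  (F.carrier ∩ I.carrier).Nonempty

/-- The pair `(F_x, I_x)`. -/
def pair (x : D) : ContextPair (StdRel D) := ⟨Fset x, Iset x⟩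

/-- The set `𝒟` of all pairs `(F_x, I_x)`. -/
def ClopenPairs (D : Type*) [DBAOps D] : Set (ContextPair (StdRel D)) :=
  Set.range (pair : D → ContextPair (StdRel D))

/-- The map `h : D → 𝒟`, `x ↦ (F_x, I_x)`. -/
def rep (x : D) : ClopenPairs D := ⟨pair x, x, rfl⟩

end Representation

/-- Stone spaces: compact, Hausdorff and totally disconnected. -/
def IsStoneSpace (X : Type*) [TopologicalSpace X] : Prop :=
  CompactSpace X ∧ T2Space X ∧ TotallyDisconnectedSpace X

end DBA

/-! This is Stone's theorem for two Boolean algebras glued together. The squares `x ⊓ x` form a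
Boolean algebra `MeetIdem D` under `⊓`, `∨`, `¬`, and a primary filter amounts to the complement of
a prime ideal there, pulled back along `square`. Dually, primary ideals live on the
join-idempotents, and passing to `Dᵒᵈ` turns each statement on filters into one on ideals. The prime
ideal theorem gives separation (`exists_primaryFilter_disjoint`). It yields `Fset_subset_iff`, hence
that `⊑` is read off from the pairs, and `upperPolar_Fset`, which couples the two sides and makes
`h` a homomorphism. The identities then pass to the image. Compactness comes from limits of
ultrafilters, separation from the clopen sets `F_x`. -/

namespace DBA

open Set Topology

/-! ### Duality -/

section Dual

variable {D : Type*} [DBAOps D]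

/-- The axioms are self-dual, so ideals need no separate arguments. -/
instance dualOps : DBAOps Dᵒᵈ where
  meet x y := OrderDual.toDual (OrderDual.ofDual x ⊔ₐ OrderDual.ofDual y)
  join x y := OrderDual.toDual (OrderDual.ofDual x ⊓ₐ OrderDual.ofDual y)
  neg x := OrderDual.toDual (⌟ₐ(OrderDual.ofDual x))
  opp x := OrderDual.toDual (¬ₐ(OrderDual.ofDual x))
  top := OrderDual.toDual ⊥ₐ
  bot := OrderDual.toDual ⊤ₐ

instance dualIsDBA [h : IsDBA D] : IsDBA Dᵒᵈ where
  ax1a := h.ax1b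
  ax1b := h.ax1a
  ax2a := h.ax2b
  ax2b := h.ax2a
  ax3a := h.ax3b
  ax3b := h.ax3a
  ax4a := h.ax4b
  ax4b := h.ax4a
  ax5a := h.ax5b
  ax5b := h.ax5a
  ax6a := h.ax6b
  ax6b := h.ax6a
  ax7a := h.ax7b
  ax7b := h.ax7a
  ax8a := h.ax8b
  ax8b := h.ax8a
  ax9a := h.ax9b
  ax9b := h.ax9a
  ax10a := h.ax10b
  ax10b := h.ax10a
  ax11a := h.ax11b
  ax11b := h.ax11a
  ax12 x := (h.ax12 x).symm

variable [IsDBA D]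

theorem dual_qle_iff (x y : D) :
    OrderDual.toDual x ⊑ₐ OrderDual.toDual y ↔ y ⊑ₐ x := by
  have h : OrderDual.toDual x ⊑ₐ OrderDual.toDual y ↔
    (x ⊔ₐ y = x ⊔ₐ x ∧ x ⊓ₐ y = y ⊓ₐ y) := Iff.rfl
  rw [h, QLE, IsDBA.ax2a y x, IsDBA.ax2b y x, and_comm]

/-- Primary ideals are the primary filters of the dual algebra. -/
def idealEquivFilter (D : Type*) [DBAOps D] [IsDBA D] :
    PrimaryIdeal D ≃ PrimaryFilter Dᵒᵈ where
  toFun I := ⟨OrderDual.ofDual ⁻¹' I.carrier,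
    ⟨I.isIdeal.join_mem, fun x hx z hxz =>
      I.isIdeal.mem_of_qle x hx z ((dual_qle_iff (D := D) x z).1 hxz)⟩,
    I.nonempty, I.proper, I.primary⟩
  invFun F := ⟨OrderDual.toDual ⁻¹' F.carrier,
    ⟨F.isFilter.meet_mem, fun x hx z hzx =>
      F.isFilter.mem_of_qle x hx z ((dual_qle_iff (D := D) x z).2 hzx)⟩,
    F.nonempty, F.proper, F.primary⟩
  left_inv _ := rfl
  right_inv _ := rfl

/-- Primary filters are the primary ideals of the dual algebra. -/
def filterEquivIdeal (D : Type*) [DBAOps D] [IsDBA D] :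
    PrimaryFilter D ≃ PrimaryIdeal Dᵒᵈ where
  toFun F := ⟨OrderDual.ofDual ⁻¹' F.carrier,
    ⟨F.isFilter.meet_mem, fun x hx z hzx =>
      F.isFilter.mem_of_qle x hx z ((dual_qle_iff (D := D) z x).1 hzx)⟩,
    F.nonempty, F.proper, F.primary⟩
  invFun I := ⟨OrderDual.toDual ⁻¹' I.carrier,
    ⟨I.isIdeal.join_mem, fun x hx z hxz =>
      I.isIdeal.mem_of_qle x hx z ((dual_qle_iff (D := D) z x).2 hxz)⟩,
    I.nonempty, I.proper, I.primary⟩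
  left_inv _ := rfl
  right_inv _ := rfl

/-- The space of primary ideals is the space of primary filters of the dual algebra. -/
def idealHomeomorphFilter (D : Type*) [DBAOps D] [IsDBA D] :
    PrimaryIdeal D ≃ₜ PrimaryFilter Dᵒᵈ where
  toEquiv := idealEquivFilter D
  continuous_toFun := by
    refine continuous_generateFrom_iff.2 ?_
    rintro _ ⟨x, rfl⟩
    exact TopologicalSpace.isOpen_generateFrom_of_mem ⟨OrderDual.ofDual x, rfl⟩
  continuous_invFun := by
    refine continuous_generateFrom_iff.2 ?_
    rintro _ ⟨x, rfl⟩
    exact TopologicalSpace.isOpen_generateFrom_of_mem ⟨OrderDual.toDual x, rfl⟩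

end Dual

/-! ### The Boolean algebra of meet-idempotent elements -/

section Algebra

variable {D : Type*} [DBAOps D] [IsDBA D]

theorem meet_comm (x y : D) : x ⊓ₐ y = y ⊓ₐ x := IsDBA.ax2a x y

theorem meet_assoc (x y z : D) : (x ⊓ₐ y) ⊓ₐ z = x ⊓ₐ (y ⊓ₐ z) := (IsDBA.ax10a x y z).symm

theorem meet_self_meet (x y : D) : (x ⊓ₐ x) ⊓ₐ y = x ⊓ₐ y := IsDBA.ax1a x y

theorem meet_meet_self (x y : D) : x ⊓ₐ (y ⊓ₐ y) = x ⊓ₐ y := by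
  rw [meet_comm, meet_self_meet, meet_comm]

theorem meet_meet_meet_comm (x y z w : D) :
    (x ⊓ₐ y) ⊓ₐ (z ⊓ₐ w) = (x ⊓ₐ z) ⊓ₐ (y ⊓ₐ w) := by
  rw [meet_assoc, meet_assoc, ← meet_assoc y z w, meet_comm y z, meet_assoc z y w]

theorem meet_idem (x y : D) : (x ⊓ₐ y) ⊓ₐ (x ⊓ₐ y) = x ⊓ₐ y := by
  rw [meet_meet_meet_comm, meet_self_meet, meet_meet_self]

theorem neg_meet_self (x : D) : ¬ₐ(x ⊓ₐ x) = ¬ₐx := IsDBA.ax3a x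

theorem neg_idem (x : D) : ¬ₐx ⊓ₐ ¬ₐx = ¬ₐx := by
  rw [← IsDBA.ax7a (¬ₐx) (¬ₐx), neg_meet_self, ← neg_meet_self x, IsDBA.ax7a]

theorem neg_neg_of_idem {x : D} (hx : x ⊓ₐ x = x) : ¬ₐ(¬ₐx) = x := by
  rw [← neg_meet_self x, IsDBA.ax7a, hx]

theorem bot_meet (x : D) : ⊥ₐ ⊓ₐ x = ⊥ₐ := by
  rw [← IsDBA.ax8a x, meet_comm, ← meet_assoc, meet_self_meet]

theorem meet_top (x : D) : x ⊓ₐ ⊤ₐ = x ⊓ₐ x := by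
  rw [← IsDBA.ax8b x, IsDBA.ax4a]

/-- The join half of `⊑` is absorption, `s ⊔ (s ⊓ t) = s ⊔ s`. -/
theorem qle_of_meet_eq {t s : D} (h : t ⊓ₐ s = t) : t ⊑ₐ s := by
  refine ⟨?_, ?_⟩
  · rw [← h, meet_assoc, meet_meet_meet_comm, meet_self_meet]
  · rw [← h, IsDBA.ax2b, meet_comm, IsDBA.ax4b]

theorem meet_qle_left (x y : D) : x ⊓ₐ y ⊑ₐ x :=
  qle_of_meet_eq (by rw [meet_comm, ← meet_assoc, meet_self_meet])

theorem meet_qle_right (x y : D) : x ⊓ₐ y ⊑ₐ y := by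
  rw [meet_comm]; exact meet_qle_left y x

theorem bot_qle (x : D) : ⊥ₐ ⊑ₐ x := qle_of_meet_eq (bot_meet x)

theorem qle_top (x : D) : x ⊑ₐ ⊤ₐ :=
  (dual_qle_iff (⊤ₐ : D) x).1 (bot_qle (D := Dᵒᵈ) (OrderDual.toDual x))

/-- Distributing `x ⊔ y` over `x ∨ y` and absorbing leaves `(x ⊓ x) ∨ (y ⊓ y) = x ∨ y`. This puts `x
∨ y` into every ideal containing `x` and `y`. -/
theorem vee_qle_join (x y : D) : vee x y ⊑ₐ x ⊔ₐ y := by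
  refine qle_of_meet_eq ?_
  rw [meet_comm, IsDBA.ax5a, meet_comm _ x, meet_comm _ y, IsDBA.ax4a,
    IsDBA.ax2b x y, IsDBA.ax4a, vee, neg_meet_self, neg_meet_self, vee]

/-- The elements idempotent for the meet. -/
def MeetIdem (D : Type*) [DBAOps D] : Type _ := {x : D // x ⊓ₐ x = x}

namespace MeetIdem

/-- The square `x ⊓ x`. -/
def square (x : D) : MeetIdem D := ⟨x ⊓ₐ x, meet_idem x x⟩

instance : Min (MeetIdem D) := ⟨fun x y => ⟨x.1 ⊓ₐ y.1, meet_idem _ _⟩⟩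

instance : Max (MeetIdem D) := ⟨fun x y => ⟨vee x.1 y.1, neg_idem _⟩⟩

instance : Compl (MeetIdem D) := ⟨fun x => ⟨¬ₐ(x.1), neg_idem _⟩⟩

theorem val_inf (x y : MeetIdem D) : (x ⊓ y).1 = x.1 ⊓ₐ y.1 := rfl

theorem val_sup (x y : MeetIdem D) : (x ⊔ y).1 = vee x.1 y.1 := rfl

theorem val_compl (x : MeetIdem D) : (xᶜ).1 = ¬ₐ(x.1) := rfl

theorem inf_comm' (x y : MeetIdem D) : x ⊓ y = y ⊓ x := Subtype.ext (meet_comm _ _)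

theorem inf_assoc' (x y z : MeetIdem D) : x ⊓ y ⊓ z = x ⊓ (y ⊓ z) :=
  Subtype.ext (meet_assoc _ _ _)

theorem compl_compl' (x : MeetIdem D) : xᶜᶜ = x := Subtype.ext (neg_neg_of_idem x.2)

theorem sup_eq (x y : MeetIdem D) : x ⊔ y = (xᶜ ⊓ yᶜ)ᶜ := rfl

theorem inf_sup_self' (x y : MeetIdem D) : x ⊓ (x ⊔ y) = x :=
  Subtype.ext ((IsDBA.ax6a x.1 y.1).trans x.2)

theorem inf_sup_left' (x y z : MeetIdem D) : x ⊓ (y ⊔ z) = (x ⊓ y) ⊔ (x ⊓ z) :=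
  Subtype.ext (IsDBA.ax5a _ _ _)

/-- Since `¬` is an involution here, the laws of `∨` are De Morgan images of those of `⊓`. -/
instance : Lattice (MeetIdem D) :=
  Lattice.mk' (fun x y => by rw [sup_eq, inf_comm', ← sup_eq])
    (fun x y z => by simp only [sup_eq, compl_compl', inf_assoc'])
    inf_comm' inf_assoc'
    (fun x y => by
      have h := inf_sup_self' xᶜ yᶜ
      rw [sup_eq, compl_compl', compl_compl'] at h
      rw [sup_eq, h, compl_compl'])
    inf_sup_self'

instance : DistribLattice (MeetIdem D) :=
  DistribLattice.ofInfSupLe fun x y z => (inf_sup_left' x y z).le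

instance : BooleanAlgebra (MeetIdem D) where
  __ := (inferInstance : DistribLattice (MeetIdem D))
  compl := compl
  -- `⊤` itself need not be meet-idempotent, whereas `⊥` is.
  top := square ⊤ₐ
  bot := ⟨⊥ₐ, bot_meet _⟩
  le_top x := inf_eq_left.1 (Subtype.ext (by
    rw [val_inf, square, meet_meet_self, meet_top, x.2]))
  bot_le x := inf_eq_left.1 (Subtype.ext (bot_meet _))
  inf_compl_le_bot x := le_of_eq (Subtype.ext (IsDBA.ax8a x.1))
  top_le_sup_compl x := le_of_eq (Subtype.ext (by
    rw [val_sup, vee, val_compl, neg_neg_of_idem x.2, meet_comm, IsDBA.ax8a, IsDBA.ax11a]; rfl))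

theorem le_iff {x y : MeetIdem D} : x ≤ y ↔ x.1 ⊓ₐ y.1 = x.1 :=
  inf_eq_left.symm.trans Subtype.ext_iff

theorem square_val (x : MeetIdem D) : square x.1 = x := Subtype.ext x.2

theorem square_le_square {x y : D} : square x ≤ square y ↔ x ⊓ₐ y = x ⊓ₐ x := by
  rw [le_iff, square, square, meet_self_meet, meet_meet_self]

theorem square_meet (x y : D) : square (x ⊓ₐ y) = square x ⊓ square y :=
  Subtype.ext (meet_meet_meet_comm _ _ _ _)

theorem square_neg (x : D) : square (¬ₐx) = (square x)ᶜ :=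
  Subtype.ext ((neg_idem x).trans (neg_meet_self x).symm)

end MeetIdem

end Algebra

/-! ### Primary filters -/

section Filters

variable {D : Type*} [DBAOps D] [IsDBA D]

namespace PrimaryFilter

variable (F : PrimaryFilter D)

theorem top_mem : ⊤ₐ ∈ F.carrier :=
  let ⟨x, hx⟩ := F.nonempty
  F.isFilter.mem_of_qle x hx _ (qle_top x)

theorem bot_notMem : ⊥ₐ ∉ F.carrier := fun h =>
  F.proper (eq_univ_of_forall fun x => F.isFilter.mem_of_qle _ h x (bot_qle x))

theorem neg_mem_iff {x : D} : ¬ₐx ∈ F.carrier ↔ x ∉ F.carrier :=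
  ⟨fun h hx => F.bot_notMem (IsDBA.ax8a x ▸ F.isFilter.meet_mem x hx _ h),
    (F.primary x).resolve_left⟩

theorem meet_mem_iff {x y : D} : x ⊓ₐ y ∈ F.carrier ↔ x ∈ F.carrier ∧ y ∈ F.carrier :=
  ⟨fun h => ⟨F.isFilter.mem_of_qle _ h _ (meet_qle_left x y),
    F.isFilter.mem_of_qle _ h _ (meet_qle_right x y)⟩,
    fun h => F.isFilter.meet_mem x h.1 y h.2⟩

end PrimaryFilter

theorem Fset_meet (x y : D) : Fset (x ⊓ₐ y) = Fset x ∩ Fset y :=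
  ext fun F => F.meet_mem_iff

theorem Fset_neg (x : D) : Fset (¬ₐx) = (Fset x)ᶜ :=
  ext fun F => F.neg_mem_iff

theorem Fset_top : Fset (⊤ₐ : D) = univ :=
  eq_univ_of_forall fun F => F.top_mem

theorem Fset_bot : Fset (⊥ₐ : D) = ∅ :=
  eq_empty_of_forall_notMem fun F => F.bot_notMem

theorem Iset_join (x y : D) : Iset (x ⊔ₐ y) = Iset x ∩ Iset y :=
  ext fun I => (idealEquivFilter D I).meet_mem_iff

theorem Iset_opp (x : D) : Iset (⌟ₐx) = (Iset x)ᶜ :=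
  ext fun I => (idealEquivFilter D I).neg_mem_iff

theorem Iset_bot : Iset (⊥ₐ : D) = univ :=
  eq_univ_of_forall fun I => (idealEquivFilter D I).top_mem

theorem Iset_top : Iset (⊤ₐ : D) = ∅ :=
  eq_empty_of_forall_notMem fun I => (idealEquivFilter D I).bot_notMem

/-- The primary filter determined by a prime ideal of the algebra of meet-idempotent elements. -/
def PrimaryFilter.ofPrimeIdeal (J : Order.Ideal (MeetIdem D)) (hJ : J.IsPrime) :
    PrimaryFilter D where
  carrier := {x | MeetIdem.square x ∉ J}
  isFilter := by
    refine ⟨fun x hx y hy h => ?_, fun x hx z hxz h => hx ?_⟩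
    · rw [MeetIdem.square_meet] at h
      exact (hJ.mem_or_mem h).elim hx hy
    · exact J.lower (MeetIdem.square_le_square.2 hxz.1) h
  nonempty := ⟨⊤ₐ, fun h => hJ.toIsProper.top_notMem h⟩
  proper h := by
    have hb : (⊥ₐ : D) ∈ {x | MeetIdem.square x ∉ J} := h ▸ mem_univ _
    refine hb (J.lower ?_ J.bot_mem)
    exact MeetIdem.le_iff.2 (by simp only [MeetIdem.square, bot_meet])
  primary x := by
    by_contra! h
    simp only [mem_ofPred_eq, not_not, MeetIdem.square_neg] at h
    refine hJ.toIsProper.top_notMem ?_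
    rw [← sup_compl_eq_top (x := MeetIdem.square x)]
    exact Order.Ideal.sup_mem h.1 h.2

theorem exists_primaryFilter_disjoint (J : Order.Ideal (MeetIdem D)) (a : MeetIdem D)
    (ha : a ∉ J) : ∃ F : PrimaryFilter D, a.1 ∈ F.carrier ∧ ∀ b ∈ J, b.1 ∉ F.carrier := by
  have hd : Disjoint (Order.PFilter.principal a : Set (MeetIdem D)) (J : Set (MeetIdem D)) :=
    disjoint_left.2 fun b hb hbJ => ha (J.lower (Order.PFilter.mem_principal.1 hb) hbJ)
  obtain ⟨P, hP, hJP, hdP⟩ := DistribLattice.prime_ideal_of_disjoint_filter_ideal hd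
  refine ⟨.ofPrimeIdeal P hP, fun h => ?_, fun b hb h => ?_⟩
  · rw [MeetIdem.square_val] at h
    exact disjoint_left.1 hdP (Order.PFilter.mem_principal.2 le_rfl) h
  · refine h ?_
    rw [MeetIdem.square_val]
    exact hJP hb

/-- The meet-idempotent elements of a primary ideal. -/
def PrimaryIdeal.meetIdemIdeal (I : PrimaryIdeal D) : Order.Ideal (MeetIdem D) where
  carrier := {x | x.1 ∈ I.carrier}
  lower' x y hyx hx :=
    I.isIdeal.mem_of_qle x.1 hx y.1 (qle_of_meet_eq (MeetIdem.le_iff.1 hyx))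
  nonempty' := ⟨⊥, (Set.ext_iff.1 (Iset_bot (D := D)) I).2 (mem_univ I)⟩
  directed' x hx y hy := ⟨x ⊔ y,
    I.isIdeal.mem_of_qle _ (I.isIdeal.join_mem _ hx _ hy) _ (vee_qle_join x.1 y.1),
    le_sup_left, le_sup_right⟩

/-- If `I` omits `a`, some primary filter contains `a` but no meet-idempotent of `I`. It misses `I`
altogether, since a common element `x` would give the common square `x ⊓ x`. Idempotency matters:
`F_x` depends only on `x ⊓ x`, but `I_x` may not. -/
theorem upperPolar_Fset {a : D} (ha : a ⊓ₐ a = a) :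
    upperPolar (StdRel D) (Fset a) = Iset a := by
  ext I
  refine ⟨fun h => ?_, fun h F hF => ⟨a, hF, h⟩⟩
  by_contra hI
  obtain ⟨F, haF, hF⟩ := exists_primaryFilter_disjoint I.meetIdemIdeal ⟨a, ha⟩ hI
  obtain ⟨x, hxF, hxI⟩ := h haF
  exact hF (MeetIdem.square x) (I.isIdeal.mem_of_qle x hxI _ (meet_qle_left x x))
    (F.isFilter.meet_mem x hxF x hxF)

theorem lowerPolar_Iset {a : D} (ha : a ⊔ₐ a = a) :
    lowerPolar (StdRel D) (Iset a) = Fset a := by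
  have h := upperPolar_Fset (D := Dᵒᵈ) (a := OrderDual.toDual a) ha
  ext F
  -- Dualizing transposes the incidence relation, so only the order of the two memberships changes.
  refine Iff.trans ?_ (Set.ext_iff.1 h (filterEquivIdeal D F))
  refine ⟨fun hF G hG => ?_, fun hF I hI => ?_⟩
  · obtain ⟨x, hx, hx'⟩ := hF (b := (idealEquivFilter D).symm G) hG
    exact ⟨OrderDual.toDual x, hx', hx⟩
  · obtain ⟨x, hx, hx'⟩ := hF (a := idealEquivFilter D I) hI
    exact ⟨OrderDual.ofDual x, hx', hx⟩

theorem Fset_subset_iff {x y : D} : Fset x ⊆ Fset y ↔ x ⊓ₐ y = x ⊓ₐ x := by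
  refine ⟨fun h => ?_, fun h F hF => ?_⟩
  · rw [← MeetIdem.square_le_square]
    by_contra hxy
    -- If the square of `x` is not below that of `y`, a primary filter separates them.
    obtain ⟨F, hxF, hF⟩ := exists_primaryFilter_disjoint
      (Order.Ideal.principal (MeetIdem.square y)) (MeetIdem.square x) hxy
    have hy : F ∈ Fset y := h (F.meet_mem_iff.1 hxF).1
    exact hF _ (Order.Ideal.mem_principal.2 le_rfl) (F.meet_mem_iff.2 ⟨hy, hy⟩)
  · have hF' : F.carrier (x ⊓ₐ y) := h ▸ F.meet_mem_iff.2 ⟨hF, hF⟩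
    exact (F.meet_mem_iff.1 hF').2

theorem Iset_subset_iff {x y : D} : Iset y ⊆ Iset x ↔ x ⊔ₐ y = y ⊔ₐ y := by
  rw [IsDBA.ax2b x y]
  refine Iff.trans ?_ (Fset_subset_iff (D := Dᵒᵈ) (x := OrderDual.toDual y)
    (y := OrderDual.toDual x))
  exact ⟨fun h F hF => h (a := (idealEquivFilter D).symm F) hF,
    fun h I hI => h (a := idealEquivFilter D I) hI⟩

theorem qle_iff_subset {x y : D} : x ⊑ₐ y ↔ Fset x ⊆ Fset y ∧ Iset y ⊆ Iset x := by
  rw [Fset_subset_iff, Iset_subset_iff, QLE]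

/-! ### Topology -/

theorem isClopen_Fset (x : D) : IsClopen (Fset x) := by
  have h (y : D) : IsClosed (Fset y) :=
    ⟨TopologicalSpace.isOpen_generateFrom_of_mem ⟨y, rfl⟩⟩
  refine ⟨h x, ?_⟩
  rw [← isClosed_compl_iff, ← Fset_neg]
  exact h _

/-- The primary filter of those `x` for which `F_x` belongs to an ultrafilter. -/
def PrimaryFilter.limit (𝒰 : Ultrafilter (PrimaryFilter D)) : PrimaryFilter D where
  carrier := {x | Fset x ∈ 𝒰}
  isFilter := by
    refine ⟨fun x hx y hy => ?_, fun x hx z hxz => ?_⟩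
    · rw [mem_ofPred_eq, Fset_meet]
      exact Filter.inter_mem hx hy
    · exact Filter.mem_of_superset hx (qle_iff_subset.1 hxz).1
  nonempty := ⟨⊤ₐ, by rw [mem_ofPred_eq, Fset_top]; exact Filter.univ_mem⟩
  proper h := by
    have hb : (⊥ₐ : D) ∈ {x | Fset x ∈ 𝒰} := h ▸ mem_univ _
    rw [mem_ofPred_eq, Fset_bot] at hb
    exact 𝒰.empty_notMem hb
  primary x := by
    simp only [mem_ofPred_eq, Fset_neg]
    exact 𝒰.mem_or_compl_mem (Fset x)

instance : CompactSpace (PrimaryFilter D) := by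
  refine ⟨isCompact_iff_ultrafilter_le_nhds.2 fun 𝒰 _ => ⟨.limit 𝒰, mem_univ _, ?_⟩⟩
  rw [TopologicalSpace.nhds_generateFrom]
  refine le_iInf₂ ?_
  -- A subbasic neighbourhood of the limit is the complement of some `F_x` that the ultrafilter does
  -- not contain.
  rintro _ ⟨hx, x, rfl⟩
  exact Filter.le_principal_iff.2 (Ultrafilter.compl_mem_iff_notMem.2 hx)

instance : TotallySeparatedSpace (PrimaryFilter D) := by
  refine totallySeparatedSpace_iff_exists_isClopen.2 fun F G hFG => ?_
  have h : ∃ x, ¬(x ∈ F.carrier ↔ x ∈ G.carrier) := by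
    by_contra! h
    exact hFG (PrimaryFilter.ext (Set.ext h))
  obtain ⟨x, hx⟩ := h
  by_cases hF : x ∈ F.carrier
  · exact ⟨Fset x, isClopen_Fset x, hF, fun hG => hx (iff_of_true hF hG)⟩
  · exact ⟨(Fset x)ᶜ, (isClopen_Fset x).compl, hF, fun hG => hx (iff_of_false hF hG)⟩

theorem isStoneSpace_primaryFilter : IsStoneSpace (PrimaryFilter D) :=
  ⟨inferInstance, inferInstance, inferInstance⟩

theorem isStoneSpace_primaryIdeal : IsStoneSpace (PrimaryIdeal D) :=
  let e := idealHomeomorphFilter D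
  ⟨e.symm.compactSpace, e.symm.t2Space, e.symm.totallyDisconnectedSpace⟩

theorem IsStoneSpace.prod {X Y : Type*} [TopologicalSpace X] [TopologicalSpace Y]
    (hX : IsStoneSpace X) (hY : IsStoneSpace Y) : IsStoneSpace (X × Y) := by
  obtain ⟨_, _, _⟩ := hX
  obtain ⟨_, _, _⟩ := hY
  exact ⟨inferInstance, inferInstance, inferInstance⟩

theorem isClopen_Iset (x : D) : IsClopen (Iset x) :=
  (isClopen_Fset (OrderDual.toDual x)).preimage (idealHomeomorphFilter D).continuous

/-! ### The representation -/

/-- Values of `⊓` and `¬` are meet-idempotent and those of `⊔` and `⌟` join-idempotent, so one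
component is the polar of the other. -/
theorem pair_isHom : IsHom (pair : D → ContextPair (StdRel D)) where
  map_meet x y := ContextPair.ext (Fset_meet x y) (by
    rw [pair, ← upperPolar_Fset (meet_idem x y), Fset_meet]; rfl)
  map_join x y := ContextPair.ext (by
    rw [pair, ← lowerPolar_Iset (a := x ⊔ₐ y) (meet_idem (D := Dᵒᵈ) x y), Iset_join]; rfl)
    (Iset_join x y)
  map_neg x := ContextPair.ext (Fset_neg x) (by
    rw [pair, ← upperPolar_Fset (neg_idem x), Fset_neg]; rfl)
  map_opp x := ContextPair.ext (by
    rw [pair, ← lowerPolar_Iset (a := ⌟ₐx) (neg_idem (D := Dᵒᵈ) x), Iset_opp]; rfl)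
    (Iset_opp x)
  map_top := ContextPair.ext Fset_top Iset_top
  map_bot := ContextPair.ext Fset_bot Iset_bot

end Filters

/-! ### Homomorphic images -/

theorem IsHom.isSubuniverse_range {A B : Type*} [DBAOps A] [DBAOps B] {f : A → B}
    (hf : IsHom f) : IsSubuniverse (range f) where
  meet_mem := by rintro _ ⟨x, rfl⟩ _ ⟨y, rfl⟩; exact ⟨_, hf.map_meet x y⟩
  join_mem := by rintro _ ⟨x, rfl⟩ _ ⟨y, rfl⟩; exact ⟨_, hf.map_join x y⟩
  neg_mem := by rintro _ ⟨x, rfl⟩; exact ⟨_, hf.map_neg x⟩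
  opp_mem := by rintro _ ⟨x, rfl⟩; exact ⟨_, hf.map_opp x⟩
  top_mem := ⟨_, hf.map_top⟩
  bot_mem := ⟨_, hf.map_bot⟩

theorem IsHom.isDBA_of_surjective {A B : Type*} [DBAOps A] [DBAOps B] [h : IsDBA A] {f : A → B}
    (hf : IsHom f) (hs : Function.Surjective f) : IsDBA B := by
  constructor <;> simp only [hs.forall, vee, wedge, ← hf.map_meet, ← hf.map_join, ← hf.map_neg,
    ← hf.map_opp, ← hf.map_top, ← hf.map_bot] <;> intros <;> apply congrArg f
  exacts [h.ax1a _ _, h.ax1b _ _, h.ax2a _ _, h.ax2b _ _, h.ax3a _, h.ax3b _, h.ax4a _ _,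
    h.ax4b _ _, h.ax5a _ _ _, h.ax5b _ _ _, h.ax6a _ _, h.ax6b _ _, h.ax7a _ _, h.ax7b _ _,
    h.ax8a _, h.ax8b _, h.ax9a, h.ax9b, h.ax10a _ _ _, h.ax10b _ _ _, h.ax11a, h.ax11b, h.ax12 _]

end DBA

theorem mainTheorem2 (D : Type*) [DBAOps D] [IsDBA D] :
    DBA.IsStoneSpace (DBA.PrimaryFilter D) ∧
    DBA.IsStoneSpace (DBA.PrimaryIdeal D) ∧
    DBA.IsStoneSpace (DBA.PrimaryFilter D × DBA.PrimaryIdeal D) ∧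
    (∀ x : D, IsClopen (DBA.Fset x) ∧ IsClopen (DBA.Iset x) ∧
      IsClopen (DBA.Fset x ×ˢ DBA.Iset x)) ∧
    ∃ hS : DBA.IsSubuniverse (DBA.ClopenPairs D),
      letI : DBAOps (DBA.ClopenPairs D) := hS.ops
      IsDBA (DBA.ClopenPairs D) ∧
      (∀ p q : DBA.ClopenPairs D,
        p ⊑ₐ q ↔ p.1.extent ⊆ q.1.extent ∧ q.1.intent ⊆ p.1.intent) ∧
      DBA.IsQuasiIso (DBA.rep : D → DBA.ClopenPairs D) ∧
      (DBA.IsContextual D → DBA.IsIso (DBA.rep : D → DBA.ClopenPairs D)) := by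
  have hF := DBA.isStoneSpace_primaryFilter (D := D)
  have hI := DBA.isStoneSpace_primaryIdeal (D := D)
  refine ⟨hF, hI, hF.prod hI, fun x => ⟨DBA.isClopen_Fset x, DBA.isClopen_Iset x,
    (DBA.isClopen_Fset x).prod (DBA.isClopen_Iset x)⟩, DBA.pair_isHom.isSubuniverse_range, ?_⟩
  let _ : DBAOps (DBA.ClopenPairs D) := (DBA.pair_isHom (D := D)).isSubuniverse_range.ops
  have hom : DBA.IsHom (DBA.rep : D → DBA.ClopenPairs D) :=
    ⟨fun x y => Subtype.ext (DBA.pair_isHom.map_meet x y),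
      fun x y => Subtype.ext (DBA.pair_isHom.map_join x y),
      fun x => Subtype.ext (DBA.pair_isHom.map_neg x),
      fun x => Subtype.ext (DBA.pair_isHom.map_opp x),
      Subtype.ext DBA.pair_isHom.map_top, Subtype.ext DBA.pair_isHom.map_bot⟩
  have surj : Function.Surjective (DBA.rep : D → DBA.ClopenPairs D) := by
    rintro ⟨_, x, rfl⟩
    exact ⟨x, rfl⟩
  have qle (p q : DBA.ClopenPairs D) :
      p ⊑ₐ q ↔ p.1.extent ⊆ q.1.extent ∧ q.1.intent ⊆ p.1.intent := by
    -- The intent of a meet is a function of its extent, so comparing extents suffices.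
    have hm : p ⊓ₐ q = p ⊓ₐ p ↔ p.1.extent ⊆ q.1.extent := by
      rw [← Set.inter_eq_left]
      refine ⟨fun h => ?_, fun h => Subtype.ext ?_⟩
      · exact (congrArg (fun r : DBA.ClopenPairs D => r.1.extent) h).trans (Set.inter_self _)
      · have h' := h.trans (Set.inter_self p.1.extent).symm
        exact DBA.ContextPair.ext h' (congrArg (upperPolar (DBA.StdRel D)) h')
    have hj : p ⊔ₐ q = q ⊔ₐ q ↔ q.1.intent ⊆ p.1.intent := by
      rw [← Set.inter_eq_right]
      refine ⟨fun h => ?_, fun h => Subtype.ext ?_⟩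
      · exact (congrArg (fun r : DBA.ClopenPairs D => r.1.intent) h).trans (Set.inter_self _)
      · have h' := h.trans (Set.inter_self q.1.intent).symm
        exact DBA.ContextPair.ext (congrArg (lowerPolar (DBA.StdRel D)) h') h'
    exact and_congr hm hj
  have qle_iff (x y : D) : x ⊑ₐ y ↔ DBA.rep x ⊑ₐ DBA.rep y :=
    DBA.qle_iff_subset.trans (qle (DBA.rep x) (DBA.rep y)).symm
  refine ⟨hom.isDBA_of_surjective surj, qle, ⟨hom, surj, qle_iff⟩, fun hD => ⟨hom, ?_, surj⟩⟩
  -- Elements with equal images lie below each other, and antisymmetry identifies them.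
  intro x y hxy
  refine hD.2.2 x y ((qle_iff x y).2 ?_) ((qle_iff y x).2 ?_) <;> rw [hxy, qle] <;>
    exact ⟨subset_rfl, subset_rfl⟩
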